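/- For an integer $N\ge 1$, $\lambda\in\mathbb{C}$ and $u\in\mathbb{R}^N$ define functions $F_N(\lambda;t,u)$ recursively by $F_1(\lambda;t,u)=e^{itu}$ and, for $N>1$, $$F_N(\lambda;t,u)=\frac{e^{iu_N(t_1+\cdots+t_N)}}{(N-1)!}\int_{\mathbb{R}^{N-1}} W_{N-1}(\lambda;s)\,\mathcal{K}_N^\sharp(\lambda;t,s)\,F_{N-1}\big(\lambda;s,(u_1-u_N,\ldots,u_{N-1}-u_N)\big)\,ds,$$ where $$W_{n}(\lambda;s)=\prod_{1\le j<k\le n}\big[4\sinh^2(s_j-s_k)\big]^{\lambda},\qquad \mathcal{K}_N^\sharp(\lambda;t,s)=\prod_{j=1}^N\prod_{k=1}^{N-1}\big[2\cosh(t_j-s_k)\big]^{-\lambda},$$ with principal branches of the powers. Put $\Lambda_1=\{\lambda\in\mathbb{C}:\operatorname{Re}\lambda>1\}$ and $\mathcal{A}_N=\{t\in\mathbb{C}^N:\max_{1\le j<k\le N}|\operatorname{Im}(t_j-t_k)|<\pi\}$ (so $\mathcal{A}_1=\mathbb{C}$). Let $N\ge 1$ and $u\in\mathbb{R}^N$.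 Then, for $N>1$, the integral defining $F_N(\lambda;t,u)$ converges absolutely whenever $\operatorname{Re}\lambda\ge 1$ and $|\operatorname{Im}t_j|<\pi/2$ for $j=1,\ldots,N$ (in particular for $t\in\mathbb{R}^N$). Moreover $F_N(\lambda;t,u)$ is holomorphic in $(\lambda,t)$ on $\Lambda_1\times\mathcal{A}_N$, in the following sense: there is a holomorphic function on $\Lambda_1\times\mathcal{A}_N$ that coincides with $F_N(\lambda;t,u)$ whenever $\lambda\in\Lambda_1$ and $|\operatorname{Im}t_j|<\pi/2$ for all $j$, and it is the only holomorphic function on $\Lambda_1\times\mathcal{A}_N$ that coincides with $F_N(\lambda;t,u)$ for all $\lambda\in\Lambda_1$ and $t\in\mathbb{R}^N$. -/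

import Mathlib

open MeasureTheory

namespace HypCM

noncomputable section

/-- The half plane `Λ_κ = {λ ∈ ℂ : Re λ > κ}`. -/
def Lam (κ : ℝ) : Set ℂ := {lam | κ < lam.re}

/-- The domain `𝒜_N = {t ∈ ℂ^N : max_{j<k} |Im (t_j - t_k)| < π}` (all of `ℂ` if `N = 1`). -/
def domA (N : ℕ) : Set (Fin N → ℂ) :=
  {t | ∀ j k : Fin N, j < k → |(t j - t k).im| < Real.pi}

/-- The polystrip `|Im t_j| < π/2`, `j = 1, …, N`; it contains `ℝ^N`. -/
def polystrip (N : ℕ) : Set (Fin N → ℂ) := {t | ∀ j, |(t j).im| < Real.pi / 2}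

/-- The weight `W_n(λ; s) = ∏_{j<k} [4 sinh² (s_j - s_k)]^λ` at real `s`; the base of every power
is a nonnegative real. -/
def weight {n : ℕ} (lam : ℂ) (s : Fin n → ℝ) : ℂ :=
  ∏ j : Fin n, ∏ k ∈ Finset.Ioi j, ((4 * Real.sinh (s j - s k) ^ 2 : ℝ) : ℂ) ^ lam

/-- The kernel `𝒦_N^♯(λ; t, s) = ∏_{j=1}^{N} ∏_{k=1}^{N-1} [2 cosh (t_j - s_k)]^{-λ}`, `N = n + 1`,
at real `s`. For `t` in the polystrip, `2 cosh (t_j - s_k)` has positive real part and the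
principal branch of the power is the one that is positive for real `t` and `λ`. -/
def kernelSharp {n : ℕ} (lam : ℂ) (t : Fin (n + 1) → ℂ) (s : Fin n → ℝ) : ℂ :=
  ∏ j : Fin (n + 1), ∏ k : Fin n, (2 * Complex.cosh (t j - (s k : ℂ))) ^ (-lam)

/-- The integrand `W_{N-1}(λ; s) 𝒦_N^♯(λ; t, s) F_{N-1}(s, (u_1 - u_N, …, u_{N-1} - u_N))`,
`N = n + 1`, for a given function `Fprev = F_{N-1}(λ; ·, ·)`. -/
def stepIntegrand {n : ℕ} (Fprev : (Fin n → ℂ) → (Fin n → ℝ) → ℂ) (lam : ℂ)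
    (t : Fin (n + 1) → ℂ) (u : Fin (n + 1) → ℝ) (s : Fin n → ℝ) : ℂ :=
  weight lam s * kernelSharp lam t s *
    Fprev (fun k => (s k : ℂ)) (fun k => u k.castSucc - u (Fin.last n))

/-- The functions `F_N(λ; t, u)`, given by `F_1(t, u) = exp (i t u)` and, for `N > 1`, by
`F_N = exp (i u_N (t_1 + ⋯ + t_N)) / (N-1)! * ∫_{ℝ^{N-1}} W_{N-1} 𝒦_N^♯ F_{N-1} ds`.
This is meant for `Re λ ≥ 1` and `t` in the polystrip (in particular for real `t`). The value for
`N = 0` is a convention that the recursion does not use. -/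
def F : (N : ℕ) → ℂ → (Fin N → ℂ) → (Fin N → ℝ) → ℂ
  | 0, _, _, _ => 1
  | 1, _, t, u => Complex.exp (Complex.I * t 0 * (u 0 : ℂ))
  | n + 2, lam, t, u =>
      Complex.exp (Complex.I * (u (Fin.last (n + 1)) : ℂ) * ∑ j, t j) / ((n + 1).factorial : ℂ) *
        ∫ s : Fin (n + 1) → ℝ, stepIntegrand (F (n + 1) lam) lam t u s

/-- The integrand `I_N(λ; t, u, s)` that defines `F_N`, `N = n + 1`. -/
def integrand (n : ℕ) (lam : ℂ) (t : Fin (n + 1) → ℂ) (u : Fin (n + 1) → ℝ) (s : Fin n → ℝ) : ℂ :=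
  stepIntegrand (F n lam) lam t u s

end

end HypCM

/-!
Write `distSum x y = ∑ j, ∑ k, |x j - y k|`. The weight `W_n(λ; s)` grows at most like
`exp (Re λ * distSum s s)`, and for `t` in the polystrip the kernel decays at least like
`exp (-Re λ * distSum (Re t) s)`. If `x` has one point more than `y`, then
`distSum x x + distSum y y ≤ 2 * distSum x y`: in terms of the counting functions of the two
families, the difference of the two sides is the integral of `2 d (d - 1) ≥ 0`, where `d` is an
integer. By induction on `N` this gives, for every `θ ∈ (0, 1]`, a decay of `F_N` at real `t` at
least like `exp (-Re λ * (1 - θ) / 2 * distSum t t)`; hence the integrand is dominated by an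
integrable function, locally uniformly in `(λ, t)`, and `F_N` is holomorphic for `Re λ > 0` and `t`
in the polystrip.

A simultaneous real translation of the `t_j` by `y` multiplies `F_N` by `exp (i y (u_1 + ⋯ + u_N))`.
The quotient of `F_N` by a plane wave with the same behaviour is therefore constant on the slices
of the polystrip by complex lines in the direction `(1, …, 1)`. Each point of `𝒜_N` lies on such a
line that meets the polystrip, which yields the continuation. For uniqueness, apply the identity
theorem on the complex lines `z ↦ Re t + z Im t`, which map real `z` into `ℝ^N`.
-/

namespace HypCM

noncomputable section

open Filter Topology Finset

section DistSum

variable {ι κ : Type*} [Fintype ι] [Fintype κ]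

/-- The sum of the distances between the points of two finite families of reals. It measures the
size of the kernel `𝒦_N^♯(t, s)`, and `distSum s s` that of the weight `W_n(s)`. -/
def distSum (x : ι → ℝ) (y : κ → ℝ) : ℝ := ∑ j, ∑ k, |x j - y k|

/-- The counting function of a finite family of reals: the number of its points below `r`. -/
def countBelow (x : ι → ℝ) (r : ℝ) : ℕ := #{j | x j < r}

theorem distSum_nonneg (x : ι → ℝ) (y : κ → ℝ) : 0 ≤ distSum x y :=
  sum_nonneg fun _ _ => sum_nonneg fun _ _ => abs_nonneg _

theorem sum_abs_sub_le_distSum (x : ι → ℝ) (y : κ → ℝ) (j : ι) :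
    ∑ k, |x j - y k| ≤ distSum x y :=
  single_le_sum (f := fun j => ∑ k, |x j - y k|)
    (fun _ _ => sum_nonneg fun _ _ => abs_nonneg _) (mem_univ j)

theorem sum_abs_sub_le_card_mul_add_distSum (a : ℝ) (x : ι → ℝ) (y : κ → ℝ) (j : ι) :
    ∑ k, |a - y k| ≤ Fintype.card κ * |a - x j| + distSum x y :=
  calc ∑ k, |a - y k| ≤ ∑ k, (|a - x j| + |x j - y k|) := by
        gcongr
        exact abs_sub_le _ _ _
    _ = Fintype.card κ * |a - x j| + ∑ k, |x j - y k| := by simp [sum_add_distrib]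
    _ ≤ Fintype.card κ * |a - x j| + distSum x y := by
        gcongr
        exact sum_abs_sub_le_distSum x y j

theorem sum_sum_Ioi_two_mul_abs_sub [LinearOrder ι] [LocallyFiniteOrderTop ι]
    [LocallyFiniteOrderBot ι] (x : ι → ℝ) :
    ∑ j, ∑ k ∈ Ioi j, 2 * |x j - x k| = distSum x x := by
  have h := sum_sum_Ioi_add_eq_sum_sum_off_diag fun j k => |x j - x k|
  simp only [abs_sub_comm, ← two_mul] at h
  rw [h, distSum]
  refine sum_congr rfl fun j _ => ?_
  rw [← sum_compl_add_sum {j}, sum_singleton, sub_self, abs_zero, add_zero]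

theorem integrable_indicator_uIoc (a b : ℝ) : Integrable ((Set.uIoc a b).indicator (1 : ℝ → ℝ)) :=
  (integrable_indicator_iff measurableSet_uIoc).mpr (integrableOn_const (by simp))

theorem integral_indicator_uIoc (a b : ℝ) : ∫ r, (Set.uIoc a b).indicator 1 r = |a - b| := by
  rw [integral_indicator_one measurableSet_uIoc, measureReal_def, Real.volume_uIoc,
    ENNReal.toReal_ofReal (abs_nonneg _), abs_sub_comm]

theorem integrable_sum_sum_indicator_uIoc (x : ι → ℝ) (y : κ → ℝ) :
    Integrable fun r => ∑ j, ∑ k, (Set.uIoc (x j) (y k)).indicator (1 : ℝ → ℝ) r :=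
  integrable_finsetSum _ fun _ _ => integrable_finsetSum _ fun _ _ =>
    integrable_indicator_uIoc _ _

theorem distSum_eq_integral (x : ι → ℝ) (y : κ → ℝ) :
    distSum x y = ∫ r, ∑ j, ∑ k, (Set.uIoc (x j) (y k)).indicator 1 r := by
  rw [integral_finsetSum _ fun _ _ =>
    integrable_finsetSum _ fun _ _ => integrable_indicator_uIoc _ _]
  simp only [integral_finsetSum _ fun _ _ => integrable_indicator_uIoc _ _,
    integral_indicator_uIoc, distSum]

theorem cast_countBelow (x : ι → ℝ) (r : ℝ) :
    (countBelow x r : ℝ) = ∑ j, if x j < r then 1 else 0 := by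
  simp [countBelow]

theorem sum_sum_indicator_uIoc (x : ι → ℝ) (y : κ → ℝ) (r : ℝ) :
    ∑ j, ∑ k, (Set.uIoc (x j) (y k)).indicator 1 r =
      (countBelow x r * (Fintype.card κ - countBelow y r) +
        (Fintype.card ι - countBelow x r) * countBelow y r : ℝ) := by
  have hind (a b : ℝ) : (Set.uIoc a b).indicator 1 r =
      ((if a < r then 1 else 0) * (1 - if b < r then 1 else 0) +
        (1 - if a < r then 1 else 0) * if b < r then 1 else 0 : ℝ) := by
    simp only [Set.indicator, Set.mem_uIoc, Pi.one_apply]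
    grind
  simp only [hind, sum_add_distrib, ← sum_mul_sum, sum_sub_distrib, ← cast_countBelow, sum_const,
    card_univ, nsmul_eq_mul, mul_one]

theorem distSum_self_add_distSum_self_le (hcard : Fintype.card ι = Fintype.card κ + 1)
    (x : ι → ℝ) (y : κ → ℝ) : distSum x x + distSum y y ≤ 2 * distSum x y := by
  simp only [distSum_eq_integral]
  rw [← integral_add (integrable_sum_sum_indicator_uIoc x x)
    (integrable_sum_sum_indicator_uIoc y y), ← integral_const_mul]
  refine integral_mono
    ((integrable_sum_sum_indicator_uIoc x x).add (integrable_sum_sum_indicator_uIoc y y))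
    ((integrable_sum_sum_indicator_uIoc x y).const_mul 2) fun r => ?_
  simp only [sum_sum_indicator_uIoc, hcard]
  -- The difference of the two sides is `2 d (d - 1)`, with the integer `d` below.
  have hmul (d : ℤ) : 0 ≤ d * (d - 1) := by
    rcases le_or_gt d 0 with h | h
    · exact mul_nonneg_of_nonpos_of_nonpos h (by lia)
    · exact mul_nonneg h.le (by lia)
  have hd : (0 : ℝ) ≤
      (countBelow x r - countBelow y r) * (countBelow x r - countBelow y r - 1) := by
    exact_mod_cast hmul ((countBelow x r : ℤ) - (countBelow y r : ℤ))
  push_cast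
  linarith

theorem card_mul_distSum_self_le (x : ι → ℝ) (y : κ → ℝ) :
    Fintype.card ι * distSum y y ≤ 2 * Fintype.card κ * distSum x y :=
  calc Fintype.card ι * distSum y y = ∑ _i : ι, ∑ j, ∑ k, |y j - y k| := by simp [distSum]
    _ ≤ ∑ i, ∑ j, ∑ k, (|x i - y j| + |x i - y k|) := by
        gcongr with i _ j _ k _
        rw [abs_sub_comm (x i) (y j)]
        exact abs_sub_le _ _ _
    _ = 2 * Fintype.card κ * distSum x y := by
        simp only [sum_add_distrib, sum_const, card_univ, nsmul_eq_mul, ← mul_sum, distSum]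
        ring

/-- The left side adds up the exponents of the weight, of the kernel and of `F_n`, which decays at
rate `(1 - c) / 2`. A small multiple `c` of `distSum x y` is kept for integrability in `y`, at the
price of the rate. -/
theorem decay_exponent_le {c : ℝ} (hcard : Fintype.card ι = Fintype.card κ + 1) (hc : 0 ≤ c)
    (hc1 : (2 * Fintype.card κ + 1) * c ≤ 1) (x : ι → ℝ) (y : κ → ℝ) :
    distSum y y - distSum x y - (1 - c) / 2 * distSum y y ≤
      -((1 - (2 * Fintype.card κ + 1) * c) / 2 * distSum x x + c * distSum x y) := by
  have h1 := mul_le_mul_of_nonneg_left (distSum_self_add_distSum_self_le hcard x y)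
    (sub_nonneg.mpr hc1)
  have h2 := mul_le_mul_of_nonneg_left (card_mul_distSum_self_le x y) hc
  rw [hcard] at h2
  push_cast at h2
  linarith

end DistSum

theorem integrable_exp_neg_mul_abs {c : ℝ} (hc : 0 < c) :
    Integrable (fun r : ℝ => Real.exp (-c * |r|)) := by
  rw [← integrableOn_univ, ← Set.Iic_union_Ioi (a := (0 : ℝ))]
  refine IntegrableOn.union ?_ ?_
  · refine (integrableOn_exp_mul_Iic hc 0).congr_fun (fun r hr => ?_) measurableSet_Iic
    simp [abs_of_nonpos (Set.mem_Iic.mp hr)]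
  · refine (exp_neg_integrableOn_Ioi 0 hc).congr_fun (fun r hr => ?_) measurableSet_Ioi
    simp [abs_of_pos (Set.mem_Ioi.mp hr)]

theorem integrable_exp_neg_mul_sum_abs_sub {ι : Type*} [Fintype ι] {c : ℝ} (hc : 0 < c)
    (x : ι → ℝ) : Integrable (fun s : ι → ℝ => Real.exp (-c * ∑ k, |x k - s k|)) := by
  simp only [mul_sum, Real.exp_sum, abs_sub_comm (x _)]
  exact Integrable.fintype_prod (f := fun k => fun r : ℝ => Real.exp (-c * |r - x k|))
    fun k => (integrable_exp_neg_mul_abs hc).comp_sub_right (x k)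

section ParametricIntegral

theorem aestronglyMeasurable_clm_of_apply {𝕜 α E G : Type*} [NontriviallyNormedField 𝕜]
    [CompleteSpace 𝕜] [MeasurableSpace α] {μ : Measure α} [NormedAddCommGroup E] [NormedSpace 𝕜 E]
    [FiniteDimensional 𝕜 E] [NormedAddCommGroup G] [NormedSpace 𝕜 G] {L : α → E →L[𝕜] G}
    (h : ∀ v, AEStronglyMeasurable (fun a => L a v) μ) : AEStronglyMeasurable L μ := by
  let b := Module.finBasis 𝕜 E
  have hL : L = fun a => ∑ i, ContinuousLinearMap.smulRightL 𝕜 E G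
      (LinearMap.toContinuousLinearMap (b.coord i)) (L a (b i)) := by
    ext a v
    conv_lhs => rw [← b.sum_repr v, map_sum]
    simp
  rw [hL]
  exact aestronglyMeasurable_fun_sum _ fun i _ =>
    (ContinuousLinearMap.continuous _).comp_aestronglyMeasurable (h (b i))

theorem differentiableOn_integral_of_locally_dominated {α E G : Type*} [MeasurableSpace α]
    {μ : Measure α} [NormedAddCommGroup E] [NormedSpace ℂ E] [FiniteDimensional ℂ E]
    [NormedAddCommGroup G] [NormedSpace ℂ G] {U : Set E} (hU : IsOpen U) {f : E → α → G}
    (hmeas : ∀ z ∈ U, AEStronglyMeasurable (f z) μ)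
    (hdiff : ∀ a, DifferentiableOn ℂ (fun z => f z a) U)
    (hdom : ∀ z ∈ U, ∃ b : α → ℝ, Integrable b μ ∧ ∀ᶠ w in 𝓝 z, ∀ a, ‖f w a‖ ≤ b a) :
    DifferentiableOn ℂ (fun z => ∫ a, f z a ∂μ) U := by
  intro z hz
  obtain ⟨b, hb, hfb⟩ := hdom z hz
  obtain ⟨r, hr, hball⟩ := Metric.mem_nhds_iff.mp (inter_mem hfb (hU.mem_nhds hz))
  have hbound (a : α) {w : E} (hw : w ∈ Metric.ball z r) : ‖f w a‖ ≤ b a := (hball hw).1 a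
  have hzr : z ∈ Metric.ball z r := Metric.mem_ball_self hr
  have hfderiv (a : α) : HasFDerivAt (fun w => f w a) (fderiv ℂ (fun w => f w a) z) z :=
    ((hdiff a).differentiableAt (hU.mem_nhds hz)).hasFDerivAt
  -- The Schwarz lemma turns the bound `b` into a Lipschitz bound at `z`.
  have hlip (a : α) {w : E} (hw : w ∈ Metric.ball z r) :
      ‖f w a - f z a‖ ≤ 2 * b a / r * ‖w - z‖ := by
    rw [← dist_eq_norm, ← dist_eq_norm]
    refine Complex.dist_le_div_mul_dist_of_mapsTo_ball (f := fun w => f w a)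
      ((hdiff a).mono fun y hy => (hball hy).2) (fun y hy => ?_) hw
    rw [Metric.mem_closedBall, dist_eq_norm, two_mul]
    exact (norm_sub_le _ _).trans (add_le_add (hbound a hy) (hbound a hzr))
  have hfderiv_meas : AEStronglyMeasurable (fun a => fderiv ℂ (fun w => f w a) z) μ := by
    refine aestronglyMeasurable_clm_of_apply fun v => ?_
    have hline : Tendsto (fun k : ℕ => z + (k : ℂ)⁻¹ • v) atTop (𝓝 z) := by
      simpa using ((tendsto_inv_atTop_nhds_zero_nat (𝕜 := ℂ)).smul_const v).const_add z
    obtain ⟨k₀, hk₀⟩ := eventually_atTop.mp (hline.eventually (hU.mem_nhds hz))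
    refine aestronglyMeasurable_of_tendsto_ae atTop
      (f := fun k a => ((k + k₀ : ℕ) : ℂ) • (f (z + ((k + k₀ : ℕ) : ℂ)⁻¹ • v) a - f z a))
      (fun k => ((hmeas _ (hk₀ _ le_add_self)).sub (hmeas z hz)).const_smul _)
      (.of_forall fun a => (hfderiv a).lim v ?_)
    simpa only [Complex.norm_natCast, Function.comp_def] using
      tendsto_natCast_atTop_atTop.comp (tendsto_add_atTop_nat k₀)
  exact (hasFDerivAt_integral_of_dominated_loc_of_lip' (Metric.ball_mem_nhds z hr)
    (fun w hw => hmeas w (hball hw).2)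
    (hb.mono' (hmeas z hz) (.of_forall fun a => hbound a hzr)) hfderiv_meas
    (.of_forall fun a w hw => hlip a hw) ((hb.const_mul 2).div_const r)
    (.of_forall hfderiv)).2.differentiableAt.differentiableWithinAt

end ParametricIntegral

section Bounds

theorem four_mul_sinh_sq_le (x : ℝ) : 4 * Real.sinh x ^ 2 ≤ Real.exp (2 * |x|) := by
  have h : 2 * |Real.sinh x| ≤ Real.exp |x| := by
    rw [Real.abs_sinh, Real.sinh_eq]
    linarith [Real.exp_pos (-|x|)]
  calc 4 * Real.sinh x ^ 2 = (2 * |Real.sinh x|) ^ 2 := by rw [mul_pow, sq_abs]; norm_num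
    _ ≤ Real.exp |x| ^ 2 := by gcongr
    _ = Real.exp (2 * |x|) := by rw [← Real.exp_nat_mul, Nat.cast_ofNat]

theorem norm_weight_le {n : ℕ} {lam : ℂ} (hlam : 0 < lam.re) (s : Fin n → ℝ) :
    ‖weight lam s‖ ≤ Real.exp (lam.re * distSum s s) := by
  rw [← sum_sum_Ioi_two_mul_abs_sub, weight]
  simp only [norm_prod, mul_sum, Real.exp_sum]
  gcongr with j _ k _
  rw [Complex.norm_cpow_eq_rpow_re_of_nonneg (by positivity) hlam.ne', mul_comm lam.re,
    Real.exp_mul]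
  exact Real.rpow_le_rpow (by positivity) (four_mul_sinh_sq_le _) hlam.le

theorem cosh_re (z : ℂ) : (Complex.cosh z).re = Real.cosh z.re * Real.cos z.im := by
  conv_lhs => rw [← Complex.re_add_im z, Complex.cosh_add, Complex.cosh_mul_I, Complex.sinh_mul_I]
  simp [← Complex.ofReal_cosh, ← Complex.ofReal_sinh, ← Complex.ofReal_cos, ← Complex.ofReal_sin]

theorem cosh_im (z : ℂ) : (Complex.cosh z).im = Real.sinh z.re * Real.sin z.im := by
  conv_lhs => rw [← Complex.re_add_im z, Complex.cosh_add, Complex.cosh_mul_I, Complex.sinh_mul_I]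
  simp [← Complex.ofReal_cosh, ← Complex.ofReal_sinh, ← Complex.ofReal_cos, ← Complex.ofReal_sin]

theorem cosh_re_pos {z : ℂ} (hz : |z.im| < Real.pi / 2) : 0 < (Complex.cosh z).re := by
  rw [cosh_re]
  exact mul_pos (Real.cosh_pos _) (Real.cos_pos_of_mem_Ioo (abs_lt.mp hz))

theorem tan_abs {x : ℝ} (hx : |x| < Real.pi / 2) : Real.tan |x| = |Real.tan x| := by
  have h := Real.tan_nonneg_of_nonneg_of_le_pi_div_two (abs_nonneg x) hx.le
  rcases abs_choice x with hx | hx <;> rw [hx] at h ⊢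
  · exact (abs_of_nonneg h).symm
  · rw [← abs_of_nonneg h, Real.tan_neg, abs_neg]

theorem abs_arg_cosh_le {z : ℂ} (hz : |z.im| < Real.pi / 2) :
    |(Complex.cosh z).arg| ≤ |z.im| := by
  have harg : |(Complex.cosh z).arg| < Real.pi / 2 :=
    Complex.abs_arg_lt_pi_div_two_iff.mpr (Or.inl (cosh_re_pos hz))
  have htan : (Complex.cosh z).arg.tan = Real.tanh z.re * Real.tan z.im := by
    rw [Complex.tan_arg, cosh_re, cosh_im, mul_div_mul_comm, Real.tanh_eq_sinh_div_cosh,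
      Real.tan_eq_sin_div_cos]
  have htan_le : Real.tan |(Complex.cosh z).arg| ≤ Real.tan |z.im| := by
    rw [tan_abs harg, tan_abs hz, htan, abs_mul]
    exact mul_le_of_le_one_left (abs_nonneg _) (Real.abs_tanh_lt_one _).le
  have habs {x : ℝ} (hx : |x| < Real.pi / 2) : |x| ∈ Set.Ioo (-(Real.pi / 2)) (Real.pi / 2) :=
    ⟨by linarith [abs_nonneg x, Real.pi_pos], hx⟩
  exact (Real.strictMonoOn_tan.le_iff_le (habs harg) (habs hz)).mp htan_le

theorem norm_two_mul_cosh_cpow_neg_le {lam z : ℂ} (hlam : 0 ≤ lam.re) (hz : |z.im| < Real.pi / 2) :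
    ‖(2 * Complex.cosh z) ^ (-lam)‖ ≤
      Real.cos z.im ^ (-lam.re) * Real.exp (|lam.im| * |z.im|) *
        Real.exp (-lam.re * |z.re|) := by
  have hcos : 0 < Real.cos z.im := Real.cos_pos_of_mem_Ioo (abs_lt.mp hz)
  have hnorm : Real.cos z.im * Real.exp |z.re| ≤ ‖2 * Complex.cosh z‖ :=
    calc Real.cos z.im * Real.exp |z.re| ≤ Real.cos z.im * (2 * Real.cosh z.re) := by
          gcongr
          exact Real.exp_abs_le z.re |>.trans_eq (by rw [Real.cosh_eq]; ring)
      _ = (2 * Complex.cosh z).re := by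
        rw [← Complex.ofReal_ofNat, Complex.re_ofReal_mul, cosh_re]
        ring
      _ ≤ ‖2 * Complex.cosh z‖ := Complex.re_le_norm _
  have harg : -((2 * Complex.cosh z).arg * (-lam).im) ≤ |lam.im| * |z.im| :=
    calc -((2 * Complex.cosh z).arg * (-lam).im) = lam.im * (Complex.cosh z).arg := by
          rw [Complex.neg_im, ← Complex.ofReal_ofNat, Complex.arg_real_mul _ two_pos]; ring
      _ ≤ |lam.im| * |(Complex.cosh z).arg| := (le_abs_self _).trans_eq (abs_mul _ _)
      _ ≤ |lam.im| * |z.im| :=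
        mul_le_mul_of_nonneg_left (abs_arg_cosh_le hz) (abs_nonneg _)
  calc ‖(2 * Complex.cosh z) ^ (-lam)‖
      ≤ ‖2 * Complex.cosh z‖ ^ (-lam.re) *
          Real.exp (-((2 * Complex.cosh z).arg * (-lam).im)) := by
        rw [Real.exp_neg, ← div_eq_mul_inv]
        exact Complex.norm_cpow_le _ _
    _ ≤ (Real.cos z.im * Real.exp |z.re|) ^ (-lam.re) * Real.exp (|lam.im| * |z.im|) := by
        gcongr ?_ * Real.exp ?_
        exact Real.rpow_le_rpow_of_nonpos (by positivity) hnorm (by linarith)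
    _ = _ := by
        rw [Real.mul_rpow hcos.le (Real.exp_pos _).le, ← Real.exp_mul, mul_comm |z.re|]
        ring

/-- The constant in the bound `norm_kernelSharp_le` for the kernel `𝒦_N^♯(λ; t, ·)`, `N = n + 1`,
at a point `t` of the polystrip; it equals `1` at real `t`. -/
def kernelBound {n : ℕ} (lam : ℂ) (t : Fin (n + 1) → ℂ) : ℝ :=
  ∏ j, (Real.cos (t j).im ^ (-lam.re) * Real.exp (|lam.im| * |(t j).im|)) ^ n

theorem kernelBound_ofReal {n : ℕ} (lam : ℂ) (x : Fin (n + 1) → ℝ) :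
    kernelBound lam (fun j => (x j : ℂ)) = 1 := by
  simp [kernelBound]

theorem kernelBound_nonneg {n : ℕ} (lam : ℂ) {t : Fin (n + 1) → ℂ} (ht : t ∈ polystrip (n + 1)) :
    0 ≤ kernelBound lam t := by
  refine prod_nonneg fun j _ => pow_nonneg (mul_nonneg ?_ (Real.exp_pos _).le) n
  exact Real.rpow_nonneg (Real.cos_pos_of_mem_Ioo (abs_lt.mp (ht j))).le _

theorem norm_kernelSharp_le {n : ℕ} {lam : ℂ} (hlam : 0 ≤ lam.re) {t : Fin (n + 1) → ℂ}
    (ht : t ∈ polystrip (n + 1)) (s : Fin n → ℝ) :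
    ‖kernelSharp lam t s‖ ≤
      kernelBound lam t * Real.exp (-lam.re * distSum (fun j => (t j).re) s) := by
  have hfactor (j : Fin (n + 1)) (k : Fin n) := norm_two_mul_cosh_cpow_neg_le
    (z := t j - (s k : ℂ)) hlam (by simpa using ht j)
  simp only [Complex.sub_re, Complex.sub_im, Complex.ofReal_re, Complex.ofReal_im, sub_zero]
    at hfactor
  calc ‖kernelSharp lam t s‖
      ≤ ∏ j, ∏ k, (Real.cos (t j).im ^ (-lam.re) * Real.exp (|lam.im| * |(t j).im|) *
          Real.exp (-lam.re * |(t j).re - s k|)) := by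
        simp only [kernelSharp, norm_prod]
        gcongr with j _ k _
        exact hfactor j k
    _ = _ := by
        simp only [kernelBound, distSum, mul_sum, Real.exp_sum, prod_mul_distrib, prod_const,
          card_univ, Fintype.card_fin, mul_pow]

end Bounds

section Integrand

theorem norm_stepIntegrand_le {n : ℕ} {lam : ℂ} (hlam : 0 < lam.re) {C c : ℝ} (hc : 0 ≤ c)
    (hc1 : (2 * n + 1) * c ≤ 1) {t : Fin (n + 1) → ℂ} (ht : t ∈ polystrip (n + 1)) {s : Fin n → ℝ}
    {Fprev : (Fin n → ℂ) → (Fin n → ℝ) → ℂ}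
    (hF : ∀ v, ‖Fprev (fun k => (s k : ℂ)) v‖ ≤
      C * Real.exp (-(lam.re * ((1 - c) / 2 * distSum s s)))) (u : Fin (n + 1) → ℝ) :
    ‖stepIntegrand Fprev lam t u s‖ ≤ C * kernelBound lam t *
      Real.exp (-(lam.re * ((1 - (2 * n + 1) * c) / 2 *
        distSum (fun j => (t j).re) (fun j => (t j).re) + c * distSum (fun j => (t j).re) s))) := by
  set x : Fin (n + 1) → ℝ := fun j => (t j).re
  have hC : 0 ≤ C :=
    nonneg_of_mul_nonneg_left ((norm_nonneg _).trans (hF 0)) (Real.exp_pos _)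
  have hK := norm_kernelSharp_le hlam.le ht s
  have hK0 : 0 ≤ kernelBound lam t := kernelBound_nonneg lam ht
  have hexponent := decay_exponent_le (by simp) hc (by simpa using hc1) x s
  rw [Fintype.card_fin] at hexponent
  calc ‖stepIntegrand Fprev lam t u s‖
      ≤ Real.exp (lam.re * distSum s s) *
          (kernelBound lam t * Real.exp (-lam.re * distSum x s)) *
          (C * Real.exp (-(lam.re * ((1 - c) / 2 * distSum s s)))) := by
        rw [stepIntegrand, norm_mul, norm_mul]
        gcongr
        · exact norm_weight_le hlam s
        · exact hF _
    _ = C * kernelBound lam t *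
          Real.exp (lam.re * (distSum s s - distSum x s - (1 - c) / 2 * distSum s s)) := by
        rw [mul_sub, mul_sub, Real.exp_sub, Real.exp_sub, neg_mul, Real.exp_neg, Real.exp_neg]
        ring
    _ ≤ _ := by
        rw [← mul_neg]
        gcongr

theorem F_succ (n : ℕ) (lam : ℂ) (t : Fin (n + 1) → ℂ) (u : Fin (n + 1) → ℝ) :
    F (n + 1) lam t u =
      Complex.exp (Complex.I * (u (Fin.last n) : ℂ) * ∑ j, t j) / (n.factorial : ℂ) *
        ∫ s : Fin n → ℝ, integrand n lam t u s := by
  cases n with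
  | zero =>
    simp [F, integrand, stepIntegrand, weight, kernelSharp, integral_unique, mul_right_comm,
      measureReal_def, volume_pi]
  | succ n => rfl

theorem measurable_weight (n : ℕ) (lam : ℂ) : Measurable fun s : Fin n → ℝ => weight lam s := by
  unfold weight
  fun_prop

theorem measurable_kernelSharp (n : ℕ) (lam : ℂ) :
    Measurable fun p : (Fin (n + 1) → ℂ) × (Fin n → ℝ) => kernelSharp lam p.1 p.2 := by
  unfold kernelSharp
  fun_prop

theorem measurable_stepIntegrand {n : ℕ} {Fprev : (Fin n → ℂ) → (Fin n → ℝ) → ℂ}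
    (hF : ∀ v, Measurable fun t => Fprev t v) (lam : ℂ) (u : Fin (n + 1) → ℝ) :
    Measurable fun p : (Fin (n + 1) → ℂ) × (Fin n → ℝ) => stepIntegrand Fprev lam p.1 u p.2 := by
  unfold stepIntegrand
  exact (((measurable_weight n lam).comp measurable_snd).mul (measurable_kernelSharp n lam)).mul
    ((hF _).comp (by fun_prop))

theorem measurable_F (n : ℕ) (lam : ℂ) (u : Fin n → ℝ) : Measurable fun t => F n lam t u := by
  induction n with
  | zero => exact measurable_const
  | succ n ih =>
    simp only [F_succ]
    exact Measurable.mul (by fun_prop)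
      (measurable_stepIntegrand ih lam u).stronglyMeasurable.integral_prod_right'.measurable

theorem measurable_integrand (n : ℕ) (lam : ℂ) (t : Fin (n + 1) → ℂ) (u : Fin (n + 1) → ℝ) :
    Measurable fun s => integrand n lam t u s := by
  have h := (measurable_stepIntegrand (measurable_F n lam) lam u).comp
    (measurable_prodMk_left (x := t))
  exact h

theorem ofReal_mem_polystrip {n : ℕ} (x : Fin n → ℝ) : (fun k => (x k : ℂ)) ∈ polystrip n :=
  fun j => by simpa using Real.pi_div_two_pos

theorem norm_F_succ_le {n : ℕ} {lam : ℂ} {x u : Fin (n + 1) → ℝ} {a D : ℝ} (ha : 0 < a)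
    (hbound : ∀ s : Fin n → ℝ, ‖integrand n lam (fun k => (x k : ℂ)) u s‖ ≤
      D * Real.exp (-a * ∑ k, |x 0 - s k|)) :
    ‖F (n + 1) lam (fun k => (x k : ℂ)) u‖ ≤
      D * ∫ s : Fin n → ℝ, Real.exp (-a * ∑ k, |s k|) := by
  have hprefactor :
      ‖Complex.exp (Complex.I * (u (Fin.last n) : ℂ) * ∑ j, (x j : ℂ)) / (n.factorial : ℂ)‖ ≤
        1 := by
    rw [norm_div, mul_assoc, ← Complex.ofReal_sum, ← Complex.ofReal_mul,
      Complex.norm_exp_I_mul_ofReal, Complex.norm_natCast]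
    exact div_le_one_of_le₀ (by exact_mod_cast n.factorial_pos) (by positivity)
  calc ‖F (n + 1) lam (fun k => (x k : ℂ)) u‖
      ≤ ‖∫ s, integrand n lam (fun k => (x k : ℂ)) u s‖ := by
        rw [F_succ, norm_mul]
        exact mul_le_of_le_one_left (norm_nonneg _) hprefactor
    _ ≤ ∫ s : Fin n → ℝ, D * Real.exp (-a * ∑ k, |x 0 - s k|) :=
        norm_integral_le_of_norm_le
          ((integrable_exp_neg_mul_sum_abs_sub ha fun _ => x 0).const_mul D) (.of_forall hbound)
    _ = D * ∫ s : Fin n → ℝ, Real.exp (-a * ∑ k, |s k|) := by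
        rw [integral_const_mul]
        congr 1
        exact integral_sub_left_eq_self
          (fun s : Fin n → ℝ => Real.exp (-a * ∑ k, |s k|)) volume fun _ => x 0

theorem exists_norm_F_le (n : ℕ) {κ : ℝ} (hκ : 0 < κ) :
    ∀ θ ∈ Set.Ioc (0 : ℝ) 1, ∃ C : ℝ, 0 ≤ C ∧ ∀ lam : ℂ, κ ≤ lam.re → ∀ x u : Fin n → ℝ,
      ‖F n lam (fun k => (x k : ℂ)) u‖ ≤
        C * Real.exp (-(lam.re * ((1 - θ) / 2 * distSum x x))) := by
  induction n with
  | zero => exact fun θ _ => ⟨1, zero_le_one, fun lam _ x u => by simp [F, distSum]⟩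
  | succ n ih =>
    rintro θ ⟨hθ, hθ1⟩
    set c : ℝ := θ / (2 * n + 1)
    have hc : 0 < c := by positivity
    have hcθ : (2 * n + 1) * c = θ := mul_div_cancel₀ _ (by positivity)
    have hc1 : c ≤ 1 := (div_le_self hθ.le (by simp)).trans hθ1
    obtain ⟨C, hC, hF⟩ := ih c ⟨hc, hc1⟩
    refine ⟨C * ∫ s : Fin n → ℝ, Real.exp (-(κ * c) * ∑ k, |s k|), by positivity,
      fun lam hlam x u => ?_⟩
    rw [mul_right_comm]
    refine norm_F_succ_le (by positivity) fun s => ?_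
    calc ‖integrand n lam (fun k => (x k : ℂ)) u s‖
        ≤ C * 1 * Real.exp (-(lam.re * ((1 - θ) / 2 * distSum x x + c * distSum x s))) := by
          have h := norm_stepIntegrand_le (hκ.trans_le hlam) hc.le (hcθ.trans_le hθ1)
            (ofReal_mem_polystrip x) (hF lam hlam s) u
          rwa [hcθ, kernelBound_ofReal] at h
      _ = C * Real.exp (-(lam.re * ((1 - θ) / 2 * distSum x x))) *
            Real.exp (-(lam.re * c) * distSum x s) := by
          rw [mul_one, mul_assoc C, ← Real.exp_add]
          ring_nf
      _ ≤ C * Real.exp (-(lam.re * ((1 - θ) / 2 * distSum x x))) *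
            Real.exp (-(κ * c) * ∑ k, |x 0 - s k|) := by
          rw [neg_mul, neg_mul]
          gcongr
          · exact mul_nonneg (hκ.le.trans hlam) hc.le
          · exact sum_abs_sub_le_distSum x s 0

theorem continuousAt_kernelBound {n : ℕ} {lam : ℂ} {t : Fin (n + 1) → ℂ}
    (ht : t ∈ polystrip (n + 1)) :
    ContinuousAt (fun p : ℂ × (Fin (n + 1) → ℂ) => kernelBound p.1 p.2) (lam, t) := by
  have hcos (j : Fin (n + 1)) : Real.cos (t j).im ≠ 0 :=
    (Real.cos_pos_of_mem_Ioo (abs_lt.mp (ht j))).ne'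
  unfold kernelBound
  refine tendsto_finsetProd _ fun j _ => ?_
  refine ContinuousAt.pow (ContinuousAt.mul ?_ (by fun_prop)) n
  exact ContinuousAt.rpow (by fun_prop) (by fun_prop) (Or.inl (hcos j))

theorem isOpen_Lam (κ : ℝ) : IsOpen (Lam κ) := isOpen_lt continuous_const Complex.continuous_re

theorem isOpen_polystrip (n : ℕ) : IsOpen (polystrip n) := by
  simp only [polystrip, Set.ofPred_forall]
  exact isOpen_iInter_of_finite fun j => isOpen_lt (by fun_prop) continuous_const

theorem exists_integrable_eventually_norm_integrand_le {n : ℕ} {lam₀ : ℂ} (hlam₀ : lam₀ ∈ Lam 0)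
    {t₀ : Fin (n + 1) → ℂ} (ht₀ : t₀ ∈ polystrip (n + 1)) (u : Fin (n + 1) → ℝ) :
    ∃ b : (Fin n → ℝ) → ℝ, Integrable b ∧
      ∀ᶠ p : ℂ × (Fin (n + 1) → ℂ) in 𝓝 (lam₀, t₀), ∀ s, ‖integrand n p.1 p.2 u s‖ ≤ b s := by
  set κ : ℝ := lam₀.re / 2
  have hκ : 0 < κ := half_pos hlam₀
  set c : ℝ := 1 / (2 * n + 1)
  have hc : 0 < c := by positivity
  have hc1 : (2 * n + 1) * c = 1 := mul_div_cancel₀ _ (by positivity)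
  obtain ⟨C, hC, hF⟩ := exists_norm_F_le n hκ c ⟨hc, div_le_self zero_le_one (by simp)⟩
  refine ⟨fun s => C * (kernelBound lam₀ t₀ + 1) * Real.exp (κ * c * n) *
    Real.exp (-(κ * c) * ∑ k, |(t₀ 0).re - s k|),
    (integrable_exp_neg_mul_sum_abs_sub (by positivity) fun _ => (t₀ 0).re).const_mul _, ?_⟩
  have hlam : ∀ᶠ p : ℂ × (Fin (n + 1) → ℂ) in 𝓝 (lam₀, t₀), κ < p.1.re :=
    continuousAt_const.eventually_lt (by fun_prop) (half_lt_self hlam₀)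
  have ht : ∀ᶠ p : ℂ × (Fin (n + 1) → ℂ) in 𝓝 (lam₀, t₀), p.2 ∈ polystrip (n + 1) :=
    continuousAt_snd.eventually_mem ((isOpen_polystrip _).mem_nhds ht₀)
  have hkernel : ∀ᶠ p : ℂ × (Fin (n + 1) → ℂ) in 𝓝 (lam₀, t₀),
      kernelBound p.1 p.2 < kernelBound lam₀ t₀ + 1 :=
    (continuousAt_kernelBound ht₀).eventually_lt continuousAt_const (lt_add_one _)
  have hdist : ∀ᶠ p : ℂ × (Fin (n + 1) → ℂ) in 𝓝 (lam₀, t₀), |(t₀ 0).re - (p.2 0).re| < 1 :=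
    ContinuousAt.eventually_lt (by fun_prop) continuousAt_const (by simp)
  filter_upwards [hlam, ht, hkernel, hdist] with ⟨lam, t⟩ hlam ht hkernel hdist s
  have hsum : ∑ k, |(t₀ 0).re - s k| - n ≤ distSum (fun j => (t j).re) s := by
    have h := sum_abs_sub_le_card_mul_add_distSum (t₀ 0).re (fun j => (t j).re) s 0
    rw [Fintype.card_fin] at h
    linarith [mul_le_of_le_one_right n.cast_nonneg hdist.le]
  have hexponent : κ * (c * (∑ k, |(t₀ 0).re - s k| - n)) ≤
      lam.re * (c * distSum (fun j => (t j).re) s) :=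
    (mul_le_mul_of_nonneg_left (mul_le_mul_of_nonneg_left hsum hc.le) hκ.le).trans
      (mul_le_mul_of_nonneg_right hlam.le (mul_nonneg hc.le (distSum_nonneg _ _)))
  calc ‖integrand n lam t u s‖
      ≤ C * kernelBound lam t * Real.exp (-(lam.re * (c * distSum (fun j => (t j).re) s))) := by
        have h := norm_stepIntegrand_le (hκ.trans hlam) hc.le hc1.le ht (hF lam hlam.le s) u
        rwa [hc1, sub_self, zero_div, zero_mul, zero_add] at h
    _ ≤ C * (kernelBound lam₀ t₀ + 1) *
          Real.exp (-(κ * (c * (∑ k, |(t₀ 0).re - s k| - n)))) := by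
        have hK0 := kernelBound_nonneg lam₀ ht₀
        gcongr
    _ = _ := by
        rw [mul_assoc _ (Real.exp _), ← Real.exp_add]
        ring_nf

end Integrand

section Holomorphy

theorem integrable_integrand {n : ℕ} {lam : ℂ} (hlam : lam ∈ Lam 0) {t : Fin (n + 1) → ℂ}
    (ht : t ∈ polystrip (n + 1)) (u : Fin (n + 1) → ℝ) :
    Integrable fun s : Fin n → ℝ => integrand n lam t u s := by
  obtain ⟨b, hb, hle⟩ := exists_integrable_eventually_norm_integrand_le hlam ht u
  exact hb.mono' (measurable_integrand n lam t u).aestronglyMeasurable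
    (.of_forall hle.self_of_nhds)

theorem differentiableAt_finsetProd {ι 𝕜 E A : Type*} [NontriviallyNormedField 𝕜]
    [NormedAddCommGroup E] [NormedSpace 𝕜 E] [NormedCommRing A] [NormedAlgebra 𝕜 A] {s : Finset ι}
    {f : ι → E → A} {x : E} (hf : ∀ i ∈ s, DifferentiableAt 𝕜 (f i) x) :
    DifferentiableAt 𝕜 (fun y => ∏ i ∈ s, f i y) x := by
  classical
  exact (HasFDerivAt.finsetProd fun i hi => (hf i hi).hasFDerivAt).differentiableAt

theorem differentiableOn_weight {n : ℕ} (s : Fin n → ℝ) :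
    DifferentiableOn ℂ (fun lam => weight lam s) {0}ᶜ := fun _ hlam =>
  DifferentiableAt.differentiableWithinAt <|
    differentiableAt_finsetProd fun _ _ => differentiableAt_finsetProd fun _ _ =>
      differentiableAt_fun_id.const_cpow (Or.inr hlam)

theorem differentiableOn_kernelSharp {n : ℕ} (s : Fin n → ℝ) :
    DifferentiableOn ℂ (fun p : ℂ × (Fin (n + 1) → ℂ) => kernelSharp p.1 p.2 s)
      (Set.univ ×ˢ polystrip (n + 1)) := by
  rintro p ⟨-, ht⟩
  unfold kernelSharp
  refine DifferentiableAt.differentiableWithinAt <|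
    differentiableAt_finsetProd fun j _ => differentiableAt_finsetProd fun k _ =>
      DifferentiableAt.cpow (by fun_prop) (by fun_prop) (Or.inl ?_)
  rw [← Complex.ofReal_ofNat, Complex.re_ofReal_mul]
  exact mul_pos two_pos (cosh_re_pos (by simpa using ht j))

theorem differentiableOn_F (n : ℕ) (u : Fin n → ℝ) :
    DifferentiableOn ℂ (fun p : ℂ × (Fin n → ℂ) => F n p.1 p.2 u) (Lam 0 ×ˢ polystrip n) := by
  induction n with
  | zero => exact differentiableOn_const _
  | succ n ih =>
    simp only [F_succ]
    refine DifferentiableOn.mul (by fun_prop) ?_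
    refine differentiableOn_integral_of_locally_dominated
      (f := fun (p : ℂ × (Fin (n + 1) → ℂ)) s => integrand n p.1 p.2 u s)
      ((isOpen_Lam 0).prod (isOpen_polystrip (n + 1)))
      (fun p _ => (measurable_integrand n p.1 p.2 u).aestronglyMeasurable) (fun s => ?_)
      fun p hp => exists_integrable_eventually_norm_integrand_le hp.1 hp.2 u
    have hweight : DifferentiableOn ℂ (fun p : ℂ × (Fin (n + 1) → ℂ) => weight p.1 s)
        (Lam 0 ×ˢ polystrip (n + 1)) :=
      (differentiableOn_weight s).comp differentiableOn_fst fun p hp h0 => by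
        have hre : 0 < p.1.re := hp.1
        rw [Set.mem_singleton_iff.mp h0, Complex.zero_re] at hre
        exact hre.false
    have hkernel := (differentiableOn_kernelSharp s).mono
      (Set.prod_mono_left (Set.subset_univ (Lam 0)))
    have hF := (ih fun k => u k.castSucc - u (Fin.last n)).comp
      (f := fun p : ℂ × (Fin (n + 1) → ℂ) => (p.1, fun k => (s k : ℂ)))
      (s := Lam 0 ×ˢ polystrip (n + 1)) (by fun_prop)
      fun p hp => ⟨hp.1, ofReal_mem_polystrip s⟩
    exact (hweight.mul hkernel).mul hF

end Holomorphy

section ComplexLines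

variable {E G : Type*} [NormedAddCommGroup E] [NormedSpace ℂ E] [NormedAddCommGroup G]
  [NormedSpace ℂ G] {U : Set E}

theorem convex_setOf_add_smul_mem (hU : Convex ℝ U) (x v : E) :
    Convex ℝ {z : ℂ | x + z • v ∈ U} :=
  (hU.translate_preimage_right x).linear_preimage
    ((LinearMap.toSpanSingleton ℂ E v).restrictScalars ℝ)

theorem isOpen_setOf_add_smul_mem (hU : IsOpen U) (x v : E) : IsOpen {z : ℂ | x + z • v ∈ U} :=
  hU.preimage (by fun_prop)

theorem eq_of_forall_add_ofReal_smul_eq (hUo : IsOpen U) (hUc : Convex ℝ U) {f : E → G}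
    (hf : DifferentiableOn ℂ f U) {v : E} (hinv : ∀ x ∈ U, ∀ y : ℝ, f (x + (y : ℂ) • v) = f x)
    {x : E} {z w : ℂ} (hz : x + z • v ∈ U) (hw : x + w • v ∈ U) :
    f (x + z • v) = f (x + w • v) := by
  let φ : ℂ → G := fun z => f (x + z • v)
  have hφ : DifferentiableOn ℂ φ {z | x + z • v ∈ U} :=
    hf.comp (f := fun z : ℂ => x + z • v) (by fun_prop) fun _ h => h
  have hVo := isOpen_setOf_add_smul_mem hUo x v
  refine hVo.is_const_of_deriv_eq_zero (convex_setOf_add_smul_mem hUc x v).isPreconnected hφ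
    (fun ζ hζ => ?_) hz hw
  have hderiv : HasDerivAt φ (deriv φ ζ) (ζ + ((0 : ℝ) : ℂ)) := by
    simpa using (hφ.differentiableAt (hVo.mem_nhds hζ)).hasDerivAt
  have hline : HasDerivAt (fun y : ℝ => ζ + (y : ℂ)) 1 0 :=
    Complex.ofRealCLM.hasDerivAt.const_add ζ
  have hconst : (φ ∘ fun y : ℝ => ζ + (y : ℂ)) = fun _ => φ ζ :=
    funext fun y => by simpa only [φ, Function.comp, add_smul, add_assoc] using hinv _ hζ y
  have h := hderiv.scomp (0 : ℝ) hline
  rw [hconst, one_smul] at h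
  exact h.unique (hasDerivAt_const 0 (φ ζ))

theorem exists_differentiableOn_eqOn_of_forall_add_ofReal_smul_eq (hUo : IsOpen U)
    (hUc : Convex ℝ U) {f : E → G} (hf : DifferentiableOn ℂ f U) {v : E}
    (hinv : ∀ x ∈ U, ∀ y : ℝ, f (x + (y : ℂ) • v) = f x) :
    ∃ g : E → G, DifferentiableOn ℂ g {x | ∃ z : ℂ, x + z • v ∈ U} ∧ Set.EqOn g f U := by
  let g : E → G := fun x => f (x + Classical.epsilon (fun z : ℂ => x + z • v ∈ U) • v)
  have hg {x : E} {z : ℂ} (hz : x + z • v ∈ U) : g x = f (x + z • v) :=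
    eq_of_forall_add_ofReal_smul_eq hUo hUc hf hinv
      (Classical.epsilon_spec (p := fun z : ℂ => x + z • v ∈ U) ⟨z, hz⟩) hz
  refine ⟨g, ?_, fun x hx => by simpa using hg (x := x) (z := 0) (by simpa using hx)⟩
  rintro x ⟨z, hz⟩
  have hfz : DifferentiableAt ℂ (fun y => f (y + z • v)) x :=
    DifferentiableAt.comp x (hf.differentiableAt (hUo.mem_nhds hz)) (by fun_prop)
  have hnear : ∀ᶠ y in 𝓝 x, y + z • v ∈ U :=
    ContinuousAt.eventually_mem (by fun_prop) (hUo.mem_nhds hz)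
  exact (hfz.congr_of_eventuallyEq (hnear.mono fun y hy => hg hy)).differentiableWithinAt

theorem eqOn_of_eq_ofReal {ι : Type*} [Finite ι] [CompleteSpace G] {U : Set (ι → ℂ)}
    (hUo : IsOpen U) (hUc : Convex ℝ U) (hU : ∀ x : ι → ℝ, (fun j => (x j : ℂ)) ∈ U)
    {f g : (ι → ℂ) → G} (hf : DifferentiableOn ℂ f U) (hg : DifferentiableOn ℂ g U)
    (hfg : ∀ x : ι → ℝ, f (fun j => (x j : ℂ)) = g fun j => (x j : ℂ)) : Set.EqOn f g U := by
  have := Fintype.ofFinite ι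
  intro t ht
  let a : ι → ℂ := fun j => (t j).re
  let b : ι → ℂ := fun j => (t j).im
  have hreal (y : ℝ) :
      a + (y : ℂ) • b = fun j => (((t j).re + y * (t j).im : ℝ) : ℂ) := by
    ext j; simp [a, b]
  have hI : a + Complex.I • b = t := by
    ext j; simp only [a, b, Pi.add_apply, Pi.smul_apply, smul_eq_mul, mul_comm Complex.I,
      Complex.re_add_im]
  have hVo := isOpen_setOf_add_smul_mem hUo a b
  have hanalytic {h : (ι → ℂ) → G} (hh : DifferentiableOn ℂ h U) :
      AnalyticOnNhd ℂ (fun z : ℂ => h (a + z • b)) {z | a + z • b ∈ U} :=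
    (hh.comp (f := fun z : ℂ => a + z • b) (by fun_prop) fun _ hz => hz).analyticOnNhd hVo
  have hfreq : ∃ᶠ z in 𝓝[≠] (0 : ℂ), f (a + z • b) = g (a + z • b) := by
    have hofReal : Tendsto (fun y : ℝ => (y : ℂ)) (𝓝[≠] 0) (𝓝[≠] 0) :=
      (Complex.continuous_ofReal.tendsto' 0 0 Complex.ofReal_zero).inf
        (tendsto_principal_principal.mpr fun y hy => Complex.ofReal_ne_zero.mpr hy)
    refine hofReal.frequently (Eventually.frequently (.of_forall fun y => ?_))
    rw [hreal]
    exact hfg _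
  have h0 : (0 : ℂ) ∈ {z : ℂ | a + z • b ∈ U} := by
    simpa [a] using hU fun j => (t j).re
  have h := (hanalytic hf).eqOn_of_preconnected_of_frequently_eq (hanalytic hg)
    (convex_setOf_add_smul_mem hUc a b).isPreconnected h0 hfreq
    (show a + Complex.I • b ∈ U by rwa [hI])
  simpa only [hI] using h

theorem eqOn_prod_of_eq_ofReal {ι : Type*} [Finite ι] [CompleteSpace G] {S : Set E}
    {U : Set (ι → ℂ)} (hUo : IsOpen U) (hUc : Convex ℝ U)
    (hU : ∀ x : ι → ℝ, (fun j => (x j : ℂ)) ∈ U) {f g : E × (ι → ℂ) → G}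
    (hf : DifferentiableOn ℂ f (S ×ˢ U)) (hg : DifferentiableOn ℂ g (S ×ˢ U))
    (hfg : ∀ p ∈ S, ∀ x : ι → ℝ, f (p, fun j => (x j : ℂ)) = g (p, fun j => (x j : ℂ))) :
    Set.EqOn f g (S ×ˢ U) := by
  have := Fintype.ofFinite ι
  rintro ⟨p, t⟩ ⟨hp, ht⟩
  have hslice {h : E × (ι → ℂ) → G} (hh : DifferentiableOn ℂ h (S ×ˢ U)) :
      DifferentiableOn ℂ (fun t => h (p, t)) U :=
    hh.comp (f := fun t => (p, t)) (by fun_prop) fun _ ht => ⟨hp, ht⟩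
  exact eqOn_of_eq_ofReal hUo hUc hU (hslice hf) (hslice hg) (hfg p hp) ht

end ComplexLines

section Extension

theorem F_add_ofReal_smul_one (n : ℕ) (lam : ℂ) (t : Fin n → ℂ) (u : Fin n → ℝ) (y : ℝ) :
    F n lam (t + (y : ℂ) • 1) u =
      Complex.exp (Complex.I * y * ∑ j, (u j : ℂ)) * F n lam t u := by
  induction n with
  | zero => simp [F]
  | succ n ih =>
    have hintegrand (s : Fin n → ℝ) : integrand n lam (t + (y : ℂ) • 1) u (s + fun _ => y) =
        Complex.exp (Complex.I * y * ∑ k : Fin n, (u k.castSucc - u (Fin.last n) : ℂ)) *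
          integrand n lam t u s := by
      have hF := ih (fun k => (s k : ℂ)) fun k => u k.castSucc - u (Fin.last n)
      have hs : (fun k => ((s k + y : ℝ) : ℂ)) = (fun k => (s k : ℂ)) + (y : ℂ) • 1 := by
        ext k
        simp
      simp only [integrand, stepIntegrand, Pi.add_apply, hs, hF]
      simp only [weight, kernelSharp, Pi.add_apply, Pi.smul_apply, Pi.one_apply, smul_eq_mul,
        mul_one, add_sub_add_right_eq_sub, Complex.ofReal_add, Complex.ofReal_sub]
      ring
    have hphase : Complex.exp (Complex.I * u (Fin.last n) * ∑ j, (t + (y : ℂ) • 1) j) *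
        Complex.exp (Complex.I * y * ∑ k : Fin n, (u k.castSucc - u (Fin.last n) : ℂ)) =
          Complex.exp (Complex.I * y * ∑ j, (u j : ℂ)) *
            Complex.exp (Complex.I * u (Fin.last n) * ∑ j, t j) := by
      rw [← Complex.exp_add, ← Complex.exp_add, Fin.sum_univ_castSucc fun j => (u j : ℂ)]
      simp only [Pi.add_apply, Pi.smul_apply, Pi.one_apply, smul_eq_mul, mul_one, sum_add_distrib,
        sum_sub_distrib, sum_const, card_univ, Fintype.card_fin, nsmul_eq_mul]
      push_cast
      ring_nf
    rw [F_succ, F_succ, ← integral_add_right_eq_self _ fun _ => y]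
    simp only [hintegrand, integral_const_mul]
    linear_combination ((n.factorial : ℂ)⁻¹ * ∫ s, integrand n lam t u s) * hphase

theorem convex_Lam (κ : ℝ) : Convex ℝ (Lam κ) := convex_halfSpace_re_gt κ

theorem convex_polystrip (n : ℕ) : Convex ℝ (polystrip n) := by
  have hpre : polystrip n =
      ⋂ j, (Complex.imLm ∘ₗ LinearMap.proj j : (Fin n → ℂ) →ₗ[ℝ] ℝ) ⁻¹'
        Metric.ball 0 (Real.pi / 2) := by
    ext t
    simp [polystrip]
  rw [hpre]
  exact convex_iInter fun j => (convex_ball _ _).linear_preimage _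

theorem convex_domA (n : ℕ) : Convex ℝ (domA n) := by
  have hpre : domA n = ⋂ (j : Fin n) (k : Fin n) (_ : j < k),
      (Complex.imLm ∘ₗ ((LinearMap.proj j : (Fin n → ℂ) →ₗ[ℝ] ℂ) - LinearMap.proj k)) ⁻¹'
        Metric.ball 0 Real.pi := by
    ext t
    simp [domA]
  rw [hpre]
  exact convex_iInter fun j => convex_iInter fun k => convex_iInter fun _ =>
    (convex_ball _ _).linear_preimage _

theorem isOpen_domA (n : ℕ) : IsOpen (domA n) := by
  simp only [domA, Set.ofPred_forall]
  exact isOpen_iInter_of_finite fun j => isOpen_iInter_of_finite fun k =>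
    isOpen_iInter_of_finite fun _ => isOpen_lt (by fun_prop) continuous_const

theorem ofReal_mem_domA {n : ℕ} (x : Fin n → ℝ) : (fun j => (x j : ℂ)) ∈ domA n :=
  fun j k _ => by simpa using Real.pi_pos

theorem abs_im_sub_lt_of_mem_domA {n : ℕ} {t : Fin n → ℂ} (ht : t ∈ domA n) (j k : Fin n) :
    |(t j).im - (t k).im| < Real.pi := by
  rcases lt_trichotomy j k with h | rfl | h
  · simpa using ht j k h
  · simpa using Real.pi_pos
  · simpa [abs_sub_comm] using ht k j h

theorem exists_add_smul_one_mem_polystrip {n : ℕ} {t : Fin (n + 1) → ℂ} (ht : t ∈ domA (n + 1)) :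
    ∃ z : ℂ, t + z • 1 ∈ polystrip (n + 1) := by
  obtain ⟨a, ha⟩ := Finite.exists_max fun j => (t j).im
  obtain ⟨b, hb⟩ := Finite.exists_min fun j => (t j).im
  have hab := (abs_lt.mp (abs_im_sub_lt_of_mem_domA ht a b)).2
  let midrange : ℝ := ((t a).im + (t b).im) / 2
  refine ⟨(-midrange : ℝ) * Complex.I, fun j => ?_⟩
  have him : ((t + ((-midrange : ℝ) * Complex.I) • 1) j).im = (t j).im - midrange := by
    simp [sub_eq_add_neg]
  rw [him, abs_lt]
  constructor <;> dsimp only [midrange] <;> linarith [ha j, hb j]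

/-- The plane wave `exp (i (u_1 + ⋯ + u_N) (t_1 + ⋯ + t_N) / N)`, `N = n + 1`, of the centre of
mass of `t`. Dividing `F_N` by it leaves a function that is invariant under simultaneous
translations of the `t_j`. -/
def centerOfMassWave {n : ℕ} (u : Fin (n + 1) → ℝ) (t : Fin (n + 1) → ℂ) : ℂ :=
  Complex.exp (Complex.I * (∑ j, (u j : ℂ)) * ((∑ j, t j) / (n + 1)))

theorem centerOfMassWave_ne_zero {n : ℕ} (u : Fin (n + 1) → ℝ) (t : Fin (n + 1) → ℂ) :
    centerOfMassWave u t ≠ 0 :=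
  Complex.exp_ne_zero _

theorem centerOfMassWave_add_smul_one {n : ℕ} (u : Fin (n + 1) → ℝ) (t : Fin (n + 1) → ℂ) (z : ℂ) :
    centerOfMassWave u (t + z • 1) =
      Complex.exp (Complex.I * z * ∑ j, (u j : ℂ)) * centerOfMassWave u t := by
  have hn : (n + 1 : ℂ) ≠ 0 := by exact_mod_cast n.succ_ne_zero
  have hmean : (∑ j, (t + z • 1) j) / (n + 1) = z + (∑ j, t j) / (n + 1) := by
    simp only [Pi.add_apply, Pi.smul_apply, Pi.one_apply, smul_eq_mul, mul_one, sum_add_distrib,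
      sum_const, card_univ, Fintype.card_fin, nsmul_eq_mul]
    push_cast
    field_simp
    ring
  rw [centerOfMassWave, centerOfMassWave, hmean, ← Complex.exp_add]
  ring_nf

theorem differentiable_centerOfMassWave {n : ℕ} (u : Fin (n + 1) → ℝ) :
    Differentiable ℂ (centerOfMassWave u) := by
  unfold centerOfMassWave
  fun_prop

theorem exists_differentiableOn_eq_F (n : ℕ) (u : Fin (n + 1) → ℝ) :
    ∃ G : ℂ × (Fin (n + 1) → ℂ) → ℂ, DifferentiableOn ℂ G (Lam 0 ×ˢ domA (n + 1)) ∧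
      ∀ lam ∈ Lam 0, ∀ t ∈ polystrip (n + 1), G (lam, t) = F (n + 1) lam t u := by
  have hwave : Differentiable ℂ fun p : ℂ × (Fin (n + 1) → ℂ) => centerOfMassWave u p.2 :=
    (differentiable_centerOfMassWave u).comp differentiable_snd
  let f : ℂ × (Fin (n + 1) → ℂ) → ℂ := fun p => F (n + 1) p.1 p.2 u * (centerOfMassWave u p.2)⁻¹
  have hf : DifferentiableOn ℂ f (Lam 0 ×ˢ polystrip (n + 1)) :=
    (differentiableOn_F (n + 1) u).mul
      (hwave.fun_inv fun p => centerOfMassWave_ne_zero u p.2).differentiableOn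
  have hinv (p : ℂ × (Fin (n + 1) → ℂ)) (y : ℝ) :
      f (p + (y : ℂ) • ((0, 1) : ℂ × (Fin (n + 1) → ℂ))) = f p := by
    simp only [f, Prod.fst_add, Prod.snd_add, Prod.smul_fst, Prod.smul_snd, smul_zero, add_zero,
      F_add_ofReal_smul_one, centerOfMassWave_add_smul_one, ← div_eq_mul_inv,
      mul_div_mul_left _ _ (Complex.exp_ne_zero _)]
  obtain ⟨g, hg, hgf⟩ := exists_differentiableOn_eqOn_of_forall_add_ofReal_smul_eq
    ((isOpen_Lam 0).prod (isOpen_polystrip (n + 1)))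
    ((convex_Lam 0).prod (convex_polystrip (n + 1))) hf fun p _ => hinv p
  refine ⟨fun p => centerOfMassWave u p.2 * g p, hwave.differentiableOn.mul (hg.mono ?_),
    fun lam hlam t ht => ?_⟩
  · rintro ⟨lam, t⟩ ⟨hlam, ht⟩
    obtain ⟨z, hz⟩ := exists_add_smul_one_mem_polystrip ht
    exact ⟨z, by simpa using hlam, hz⟩
  · have hg_eq : g (lam, t) = F (n + 1) lam t u * (centerOfMassWave u t)⁻¹ := hgf ⟨hlam, ht⟩
    simp only [hg_eq, ← div_eq_mul_inv, mul_div_cancel₀ _ (centerOfMassWave_ne_zero u t)]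

end Extension

end

end HypCM

theorem theorem6p1_general (n : ℕ) (u : Fin (n + 1) → ℝ) {κ : ℝ} (hκ : 0 ≤ κ) :
    (∀ lam : ℂ, 0 < lam.re → ∀ t ∈ HypCM.polystrip (n + 1),
      MeasureTheory.Integrable (fun s : Fin n → ℝ => HypCM.integrand n lam t u s)) ∧
    ∃ G : ℂ × (Fin (n + 1) → ℂ) → ℂ,
      DifferentiableOn ℂ G (HypCM.Lam κ ×ˢ HypCM.domA (n + 1)) ∧
      (∀ lam ∈ HypCM.Lam κ, ∀ t ∈ HypCM.polystrip (n + 1),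
        G (lam, t) = HypCM.F (n + 1) lam t u) ∧
      ∀ G' : ℂ × (Fin (n + 1) → ℂ) → ℂ,
        DifferentiableOn ℂ G' (HypCM.Lam κ ×ˢ HypCM.domA (n + 1)) →
        (∀ lam ∈ HypCM.Lam κ, ∀ x : Fin (n + 1) → ℝ,
          G' (lam, fun j => (x j : ℂ)) = HypCM.F (n + 1) lam (fun j => (x j : ℂ)) u) →
        Set.EqOn G' G (HypCM.Lam κ ×ˢ HypCM.domA (n + 1)) := by
  refine ⟨fun lam hlam t ht => HypCM.integrable_integrand hlam ht u, ?_⟩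
  obtain ⟨G, hG, hGF⟩ := HypCM.exists_differentiableOn_eq_F n u
  have hLam {lam : ℂ} (h : lam ∈ HypCM.Lam κ) : lam ∈ HypCM.Lam 0 := hκ.trans_lt h
  have hGκ : DifferentiableOn ℂ G (HypCM.Lam κ ×ˢ HypCM.domA (n + 1)) :=
    hG.mono (Set.prod_mono_left fun _ => hLam)
  refine ⟨G, hGκ, fun lam hlam => hGF lam (hLam hlam), fun G' hG' hG'F => ?_⟩
  refine HypCM.eqOn_prod_of_eq_ofReal (HypCM.isOpen_domA _) (HypCM.convex_domA _)
    HypCM.ofReal_mem_domA hG' hGκ fun lam hlam x => ?_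
  rw [hG'F lam hlam x, hGF lam (hLam hlam) _ (HypCM.ofReal_mem_polystrip x)]

/-- With `N = n + 1 ≥ 1` and `u ∈ ℝ^N`: the integral that defines `F_N(λ; t, u)` converges
absolutely for `Re λ ≥ 1` and `t` in the polystrip `|Im t_j| < π/2`, and `F_N(λ; t, u)` extends to a
holomorphic function of `(λ, t)` on `Λ_1 × 𝒜_N`, which is determined by the values of `F_N` at
real `t`. -/
theorem theorem6p1 (n : ℕ) (u : Fin (n + 1) → ℝ) :
    (∀ lam : ℂ, 1 ≤ lam.re → ∀ t ∈ HypCM.polystrip (n + 1),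
      MeasureTheory.Integrable (fun s : Fin n → ℝ => HypCM.integrand n lam t u s)) ∧
    ∃ G : ℂ × (Fin (n + 1) → ℂ) → ℂ,
      DifferentiableOn ℂ G (HypCM.Lam 1 ×ˢ HypCM.domA (n + 1)) ∧
      (∀ lam ∈ HypCM.Lam 1, ∀ t ∈ HypCM.polystrip (n + 1),
        G (lam, t) = HypCM.F (n + 1) lam t u) ∧
      ∀ G' : ℂ × (Fin (n + 1) → ℂ) → ℂ,
        DifferentiableOn ℂ G' (HypCM.Lam 1 ×ˢ HypCM.domA (n + 1)) →
        (∀ lam ∈ HypCM.Lam 1, ∀ x : Fin (n + 1) → ℝ,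
          G' (lam, fun j => (x j : ℂ)) = HypCM.F (n + 1) lam (fun j => (x j : ℂ)) u) →
        Set.EqOn G' G (HypCM.Lam 1 ×ˢ HypCM.domA (n + 1)) :=
  ⟨fun lam hlam => (theorem6p1_general n u zero_le_one).1 lam (zero_lt_one.trans_le hlam),
    (theorem6p1_general n u zero_le_one).2⟩
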